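/- **Theorem 1.2 (Varley's Conjecture).** Let $n\ge r\ge 0$ be integers, let $m=n+r$, and let $\mathcal A$ be the algebra of germs at the origin of holomorphic functions on $\mathbb C^n\times\mathbb C^r=\mathbb C^m$, with coordinates $x_1,\dots,x_m$ (that is, $a_0,\dots,a_{n-1},b_0,\dots,b_{r-1}$) and with maximal ideal $\mathbf m$ (the germs vanishing at the origin). *Thom–Boardman symbol.* For an ideal $J\subseteq\mathcal A$ and $k\ge 0$, the Jacobian extension $\Delta_kJ$ is the ideal spanned by $J$ and all $k\times k$ minors $\det(\partial f_s/\partial x_{j_t})_{1\le s,t\le k}$ with $f_1,\dots,f_k\in J$ (the empty minor is $1$, so $\Delta_0J=\mathcal A$). $\Delta_kJ$ is called critical if $k\geq 1$, $\Delta_kJ\ne\mathcal A$ and $\Delta_{k-1}J=\mathcal A$. Put $\Delta^iJ=\Delta_{m-i+1}J$ for $0\le i\le m$. If there is a chain $$J\subseteq\Delta^{i_1}J\subseteq\Delta^{i_2}\Delta^{i_1}J\subseteq\cdots\subseteq\Delta^{i_k}\cdots\Delta^{i_1}J=\mathbf m$$ in which each term after the first is the critical extension of the preceding one and only the last term equals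 $\mathbf m$, then the Thom–Boardman symbol of $J$ is $TB(J)=(i_1,\dots,i_k)$ (it is the empty tuple if $J=\mathbf m$). *The multiplication map.* Let $\mu_{n,r}:\mathbb C^n\times\mathbb C^r\to\mathbb C^{n+r}$ send $(a_0,\dots,a_{n-1},b_0,\dots,b_{r-1})$ to the coefficients $c_0,\dots,c_{n+r-1}$ of the product $$(x^n+a_{n-1}x^{n-1}+\cdots+a_0)(x^r+b_{r-1}x^{r-1}+\cdots+b_0)=x^{n+r}+c_{n+r-1}x^{n+r-1}+\cdots+c_0,$$ and let $I(\mu_{n,r})\subseteq\mathcal A$ be the ideal generated by the germs of $c_0,\dots,c_{n+r-1}$. *The tuple.* If $r\ge1$, let $n=q_1r+r_1,\ r=q_2r_1+r_2,\ \dots,\ r_{k-1}=q_{k+1}r_k$ (where $r_0=r$) be the Euclidean algorithm on $n$ and $r$, with $r>r_1>\cdots>r_k>0$ (if $r$ divides $n$ there is only the line $n=q_1r$), and let $$I(n,r)=(\underbrace{r,\dots,r}_{q_1},\underbrace{r_1,\dots,r_1}_{q_2},\dots,\underbrace{r_k,\dots,r_k}_{q_{k+1}}).$$ If $r=0$, let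 $I(n,r)$ be the empty tuple. Then the Thom–Boardman symbol of $I(\mu_{n,r})$ exists and $TB(I(\mu_{n,r}))=I(n,r)$. -/

import Mathlib

open Filter Topology

namespace ThomBoardman

noncomputable section

/-- The algebra of germs at the origin of holomorphic functions on `ℂ^ι` (`ι` a finite set of
coordinates): those germs at `0` of functions `ℂ^ι → ℂ` which have a representative analytic
at `0`. -/
def germAlgebra (ι : Type) [Fintype ι] : Subring (Germ (𝓝 (0 : ι → ℂ)) ℂ) where
  carrier := {φ | ∃ f : (ι → ℂ) → ℂ, AnalyticAt ℂ f 0 ∧ φ = (f : Germ (𝓝 (0 : ι → ℂ)) ℂ)}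
  mul_mem' := by
    rintro _ _ ⟨f, hf, rfl⟩ ⟨g, hg, rfl⟩
    exact ⟨f * g, hf.mul hg, rfl⟩
  add_mem' := by
    rintro _ _ ⟨f, hf, rfl⟩ ⟨g, hg, rfl⟩
    exact ⟨f + g, hf.add hg, rfl⟩
  one_mem' := ⟨fun _ => 1, analyticAt_const, rfl⟩
  zero_mem' := ⟨fun _ => 0, analyticAt_const, rfl⟩
  neg_mem' := by
    rintro _ ⟨f, hf, rfl⟩
    exact ⟨-f, hf.neg, rfl⟩

/-- The germ at the origin of a function analytic at the origin. -/
def germOf {ι : Type} [Fintype ι] (f : (ι → ℂ) → ℂ) (hf : AnalyticAt ℂ f 0) : germAlgebra ι :=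
  ⟨(f : Germ (𝓝 (0 : ι → ℂ)) ℂ), f, hf, rfl⟩

/-- The maximal ideal of the algebra of germs: the germs that vanish at the origin. -/
def maxIdeal (ι : Type) [Fintype ι] : Ideal (germAlgebra ι) :=
  RingHom.ker ((Germ.valueRingHom (X := ι → ℂ) (E := ℂ) (x := 0)).comp
    (germAlgebra ι).subtype)

section Derivative

variable {ι : Type} [Fintype ι] [DecidableEq ι]

/-- The partial derivative `∂f/∂x_i` of a function `f` on `ℂ^ι`. -/
def partialFun (i : ι) (f : (ι → ℂ) → ℂ) : (ι → ℂ) → ℂ :=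
  fun x => fderiv ℂ f x (Pi.single i 1)

theorem partialFun_congr (i : ι) {f g : (ι → ℂ) → ℂ} (h : f =ᶠ[𝓝 0] g) :
    partialFun i f =ᶠ[𝓝 0] partialFun i g :=
  (h.fderiv (𝕜 := ℂ)).mono fun _ hx =>
    congrArg (fun L : (ι → ℂ) →L[ℂ] ℂ => L (Pi.single i 1)) hx

theorem partialFun_analyticAt (i : ι) {f : (ι → ℂ) → ℂ} (hf : AnalyticAt ℂ f 0) :
    AnalyticAt ℂ (partialFun i f) 0 :=
  ((ContinuousLinearMap.apply ℂ ℂ (Pi.single i (1 : ℂ) : ι → ℂ)).analyticAt _).comp hf.fderiv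

/-- The partial derivative of a germ with respect to the `i`-th coordinate. -/
def partialGerm (i : ι) (φ : germAlgebra ι) : germAlgebra ι :=
  ⟨Germ.map' (partialFun i) (fun _ _ h => partialFun_congr i h)
      (φ : Germ (𝓝 (0 : ι → ℂ)) ℂ), by
    obtain ⟨_, f, hf, rfl⟩ := φ
    exact ⟨partialFun i f, partialFun_analyticAt i hf, rfl⟩⟩

/-- The minors of order `k` of the Jacobian matrix of `J`, the matrix of the partial derivatives
of the elements of `J` (one row for each element of `J`, one column for each coordinate). The
choices of rows and columns need not be injective; a repetition gives the minor `0`. -/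
def jacobianMinors (k : ℕ) (J : Ideal (germAlgebra ι)) : Set (germAlgebra ι) :=
  {d | ∃ (f : Fin k → germAlgebra ι) (c : Fin k → ι), (∀ s, f s ∈ J) ∧
    d = (Matrix.of fun s t => partialGerm (c t) (f s)).det}

/-- The Jacobian extension `Δ_k J`: the ideal spanned by `J` and all the minors of order `k` of
its Jacobian matrix. -/
def jacobianExt (k : ℕ) (J : Ideal (germAlgebra ι)) : Ideal (germAlgebra ι) :=
  J ⊔ Ideal.span (jacobianMinors k J)

/-- `Δ_k J` is critical: it is a proper ideal, but `Δ_{k-1} J` is the whole algebra. Such a `k`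
is at least `1`, since `Δ_0 J` is the whole algebra (the empty minor is `1`). -/
def IsCritical (k : ℕ) (J : Ideal (germAlgebra ι)) : Prop :=
  jacobianExt k J ≠ ⊤ ∧ jacobianExt (k - 1) J = ⊤

/-- Upper indexing of the Jacobian extensions: `Δ^i J = Δ_{m-i+1} J`, where `m` is the number of
coordinates. It is used for `i ≤ m` only. -/
def upperExt (i : ℕ) (J : Ideal (germAlgebra ι)) : Ideal (germAlgebra ι) :=
  jacobianExt (Fintype.card ι - i + 1) J

/-- `IsTBSymbol [i₁, …, i_k] J` says that the Thom–Boardman symbol of `J` is `(i₁, …, i_k)`: in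
the chain `J ⊆ Δ^{i₁} J ⊆ Δ^{i₂} Δ^{i₁} J ⊆ ⋯` every term is the critical extension of the
previous one, and the `k`-th one is the first that is equal to the maximal ideal. -/
def IsTBSymbol : List ℕ → Ideal (germAlgebra ι) → Prop
  | [], J => J = maxIdeal ι
  | i :: l, J => J ≠ maxIdeal ι ∧ i ≤ Fintype.card ι ∧
      IsCritical (Fintype.card ι - i + 1) J ∧ IsTBSymbol l (upperExt i J)

theorem jacobianMinors_succ (k : ℕ) (J : Ideal (germAlgebra ι)) :
    jacobianMinors (k + 1) J ⊆ Ideal.span (jacobianMinors k J) := by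
  rintro _ ⟨f, c, hf, rfl⟩
  rw [Matrix.det_succ_row_zero]
  refine Ideal.sum_mem _ fun j _ => Ideal.mul_mem_left _ _ (Ideal.subset_span ?_)
  exact ⟨fun s => f s.succ, fun t => c (j.succAbove t), fun s => hf _, rfl⟩

theorem jacobianExt_antitone (J : Ideal (germAlgebra ι)) : Antitone fun k => jacobianExt k J :=
  antitone_nat_of_succ_le fun k =>
    sup_le_sup_left (Ideal.span_le.2 (jacobianMinors_succ k J)) J

theorem IsCritical.unique {J : Ideal (germAlgebra ι)} {k k' : ℕ} (h : IsCritical k J)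
    (h' : IsCritical k' J) : k = k' := by
  have key : ∀ {a b : ℕ}, IsCritical a J → IsCritical b J → ¬ a < b := fun ha hb hab =>
    ha.1 (top_le_iff.1 (hb.2.symm.le.trans (jacobianExt_antitone J (by omega))))
  have h1 := key h h'
  have h2 := key h' h
  omega

/-- An ideal has at most one Thom–Boardman symbol. -/
theorem IsTBSymbol.unique {l l' : List ℕ} {J : Ideal (germAlgebra ι)} (h : IsTBSymbol l J)
    (h' : IsTBSymbol l' J) : l = l' := by
  induction l generalizing l' J with
  | nil =>
    cases l' with
    | nil => rfl
    | cons i l' => exact absurd h h'.1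
  | cons i l ih =>
    cases l' with
    | nil => exact absurd h' h.1
    | cons i' l' =>
      obtain ⟨-, hi, hc, ht⟩ := h
      obtain ⟨-, hi', hc', ht'⟩ := h'
      have e := hc.unique hc'
      obtain rfl : i = i' := by omega
      rw [ih ht ht']

end Derivative

/-- The monic polynomial `x^n + a_{n-1} x^{n-1} + ⋯ + a_0`. -/
def monicPoly {n : ℕ} (a : Fin n → ℂ) : Polynomial ℂ :=
  Polynomial.X ^ n + ∑ i : Fin n, Polynomial.C (a i) * Polynomial.X ^ (i : ℕ)

/-- The polynomial multiplication map `μ_{n,r} : ℂ^n × ℂ^r → ℂ^{n+r}`: the coordinates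
`(a_0, …, a_{n-1}, b_0, …, b_{r-1})` of the monic polynomials `f` and `g` of degrees `n` and `r`
are sent to the non-leading coefficients `c_j`, `j < n + r`, of `f g`. -/
def mulMap (n r : ℕ) (p : Fin n ⊕ Fin r → ℂ) (j : Fin (n + r)) : ℂ :=
  (monicPoly (fun i => p (Sum.inl i)) * monicPoly (fun i => p (Sum.inr i))).coeff j

theorem mulMap_analyticAt (n r : ℕ) (j : Fin (n + r)) :
    AnalyticAt ℂ (fun p => mulMap n r p j) 0 := by
  have hproj : ∀ k : Fin n ⊕ Fin r, AnalyticAt ℂ (fun p : Fin n ⊕ Fin r → ℂ => p k) 0 :=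
    fun k => (ContinuousLinearMap.proj (R := ℂ) (φ := fun _ : Fin n ⊕ Fin r => ℂ) k).analyticAt 0
  have hcoeff : ∀ {d : ℕ} (e : Fin d → Fin n ⊕ Fin r) (s : ℕ),
      AnalyticAt ℂ (fun p : Fin n ⊕ Fin r → ℂ => (monicPoly fun i => p (e i)).coeff s) 0 := by
    intro d e s
    simp only [monicPoly, Polynomial.coeff_add, Polynomial.finsetSum_coeff,
      Polynomial.coeff_C_mul]
    exact analyticAt_const.add
      (Finset.analyticAt_fun_sum _ fun i _ => (hproj (e i)).mul analyticAt_const)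
  simp only [mulMap, Polynomial.coeff_mul]
  exact Finset.analyticAt_fun_sum _ fun x _ => (hcoeff Sum.inl x.1).mul (hcoeff Sum.inr x.2)

/-- The ideal `I(μ_{n,r})` generated by the germs at the origin of the components `c_j` of
`μ_{n,r}`. -/
def mulIdeal (n r : ℕ) : Ideal (germAlgebra (Fin n ⊕ Fin r)) :=
  Ideal.span (Set.range fun j : Fin (n + r) =>
    germOf (fun p => mulMap n r p j) (mulMap_analyticAt n r j))

/-- The tuple `I(n,r)` of the Euclidean algorithm on `n` and `r`: if `n = q r + s` with
`0 ≤ s < r`, it is `r` repeated `q` times, followed by the tuple of `r` and `s`. The algorithm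
stops when the remainder is `0`. -/
def euclidTuple (n : ℕ) : ℕ → List ℕ
  | 0 => []
  | r + 1 => List.replicate (n / (r + 1)) (r + 1) ++ euclidTuple (r + 1) (n % (r + 1))
termination_by r => r
decreasing_by exact Nat.mod_lt _ (Nat.succ_pos _)

end

end ThomBoardman

/-! The proof runs subtractive Euclid on a larger family of ideals. Take monic `f`, `g` of degrees
`n ≥ r > 0` whose lower coefficients, together with elements `H`, form a coordinate system
(`IsFactorSystem`). Let `J` be generated by `H` and the lower coefficients of `f^(a+1) * g^(b+1)`;
the multiplication map is the case of empty `H` and `a = b = 0`. Write `f = g * q + R` with `deg R <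
r`.

Lower bound: modulo `J` the product is a power of `X`, so a derivation `D` passes through division
by `f^a * g^b` and leaves `(a+1) * g * Df + (b+1) * f * Dg`. Dividing this by `g` and choosing `D`
suitably gives an identity minor of order `|H| + n`, and minors of order `|H| + n + 1` congruent to
the coefficients of `R` (`IsFactorSystem.exists_diagonal`).

Upper bound: modulo `R` one has `f = g * q`, so the derivative of the product is `f^a * g^(b+1)`
times a polynomial of degree less than `n`. The Jacobian matrix then factors through `|H| + n` rows,
and larger minors vanish (`jacobianExtOf_le_nextFactorIdeal`).

Hence the critical extension adjoins exactly the coefficients of `R`, and has index `r`, since there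
are `|H| + n + r` variables. Modulo `R` the product is `q^(a+1) * g^(a+b+2)`, and `(H, R)`, `q`, `g`
again form a coordinate system, so the extension lies in the same family with degrees `(n - r, r)`.
When `r = 0`, a root of a power of `X` must be a power of `X` in characteristic zero, and `J` is the
maximal ideal. -/

namespace ThomBoardman

open Polynomial

/-! ### Coefficientwise derivations, division by monic polynomials, and determinants -/

section Algebra

variable {A : Type*} [CommRing A]

/-- The derivation of `A[X]` that applies a derivation of `A` to the coefficients. -/
noncomputable def coeffDer (D : Derivation ℤ A A) : Derivation ℤ A[X] A[X] :=
  LinearMap.compDer (PolynomialModule.equivPolynomialSelf (R := A)).toLinearMap D.mapCoeffs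

@[simp]
theorem coeff_coeffDer (D : Derivation ℤ A A) (p : A[X]) (i : ℕ) :
    (coeffDer D p).coeff i = D (p.coeff i) := by
  rfl

theorem coeffDer_X_pow (D : Derivation ℤ A A) (n : ℕ) : coeffDer D (X ^ n) = 0 := by
  ext i
  rw [coeff_coeffDer, coeff_X_pow]
  split_ifs <;> simp

theorem degree_coeffDer_lt_of_lt (D : Derivation ℤ A A) {p : A[X]} {n : ℕ} (h : p.degree < n) :
    (coeffDer D p).degree < n := by
  rw [degree_lt_iff_coeff_zero] at h ⊢
  intro m hm
  rw [coeff_coeffDer, h m hm, map_zero]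

theorem degree_coeffDer_lt [Nontrivial A] (D : Derivation ℤ A A) {p : A[X]} (hp : p.Monic) :
    (coeffDer D p).degree < p.natDegree := by
  have h := degree_coeffDer_lt_of_lt D (p := p - X ^ p.natDegree) (n := p.natDegree) (by
    rw [← degree_eq_natDegree hp.ne_zero]
    exact degree_sub_lt_left (by rw [degree_X_pow, degree_eq_natDegree hp.ne_zero]) hp.ne_zero
      (by rw [hp.leadingCoeff, (monic_X_pow _).leadingCoeff]))
  rwa [map_sub, coeffDer_X_pow, sub_zero] at h

/-- Differentiate `E = R + q * Q`. The term `Dq * Q` dies under `φ` because `Q` does, and `DR` still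
has degree below `deg q`, so uniqueness of division applies. -/
theorem map_coeffDer_divByMonic [Nontrivial A] {B : Type*} [CommRing B] (φ : A →+* B)
    (D : Derivation ℤ A A) {q : A[X]} (hq : q.Monic) {E : A[X]} (hE : E.map φ = 0) :
    (coeffDer D (E /ₘ q)).map φ = (coeffDer D E).map φ /ₘ q.map φ ∧
      (coeffDer D (E %ₘ q)).map φ = (coeffDer D E).map φ %ₘ q.map φ := by
  nontriviality B
  have h := div_modByMonic_unique ((coeffDer D (E /ₘ q)).map φ)
    ((coeffDer D (E %ₘ q)).map φ) (hq.map φ) (f := (coeffDer D E).map φ) ⟨?_, ?_⟩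
  · exact ⟨h.1.symm, h.2.symm⟩
  · conv_rhs => rw [← modByMonic_add_div E q]
    have h0 : (E /ₘ q).map φ = 0 := by rw [map_divByMonic φ hq, hE, zero_divByMonic]
    simp only [map_add, Derivation.leibniz, smul_eq_mul, Polynomial.map_add, Polynomial.map_mul,
      h0, zero_mul, add_zero]
  · rw [hq.degree_map, degree_eq_natDegree hq.ne_zero]
    refine degree_map_le.trans_lt (degree_coeffDer_lt_of_lt D ?_)
    rw [← degree_eq_natDegree hq.ne_zero]
    exact degree_modByMonic_lt _ hq

/-- Multilinear expansion in the columns. The sum runs over all maps `c`, not only injective ones,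
which matches the minors with repetitions allowed in Jacobian extensions. -/
theorem det_mul_eq_sum {m e : Type*} [Fintype m] [DecidableEq m] [Fintype e]
    (M : Matrix m e A) (N : Matrix e m A) :
    (M * N).det = ∑ c : m → e, (∏ t, N (c t) t) * (Matrix.of fun s t => M s (c t)).det := by
  rw [← Matrix.det_transpose]
  have h : (M * N).transpose = fun t => ∑ j, N j t • M.transpose j := by
    ext t s
    simp [Matrix.mul_apply, mul_comm]
  have h' := (Matrix.detRowAlternating (n := m) (R := A)).toMultilinearMap.map_sum
    (fun t j => N j t • M.transpose j)
  rw [h]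
  refine h'.trans (Finset.sum_congr rfl fun c _ => ?_)
  rw [MultilinearMap.map_smul_univ, smul_eq_mul]
  congr 1
  rw [← Matrix.det_transpose (Matrix.of _)]
  rfl

theorem det_mul_eq_zero_of_card_lt {m e : Type*} [Fintype m] [DecidableEq m] [Fintype e]
    (M : Matrix m e A) (N : Matrix e m A) (h : Fintype.card e < Fintype.card m) :
    (M * N).det = 0 := by
  rw [det_mul_eq_sum]
  refine Finset.sum_eq_zero fun c _ => ?_
  obtain ⟨s, t, hst, hc⟩ := Fintype.exists_ne_map_eq_of_card_lt c h
  rw [Matrix.det_zero_of_column_eq hst fun i => by simp [hc], mul_zero]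

theorem det_mem_of_sub_mul_mem {m e : Type*} [Fintype m] [DecidableEq m] [Fintype e]
    {K : Ideal A} (P : Matrix m m A) (M : Matrix m e A) (N : Matrix e m A)
    (h : Fintype.card e < Fintype.card m) (hP : ∀ s t, P s t - ∑ j, M s j * N j t ∈ K) :
    P.det ∈ K := by
  rw [← Ideal.Quotient.eq_zero_iff_mem, RingHom.map_det]
  have hmul : (Ideal.Quotient.mk K).mapMatrix P =
      M.map (Ideal.Quotient.mk K) * N.map (Ideal.Quotient.mk K) := by
    ext s t
    simpa [Matrix.mul_apply] using Ideal.Quotient.eq.2 (hP s t)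
  rw [hmul, det_mul_eq_zero_of_card_lt _ _ h]

/-- The ideal generated by the coefficients of `P - X ^ deg P`. -/
noncomputable def lowerIdeal (P : A[X]) : Ideal A :=
  Ideal.span (Set.range (P - X ^ P.natDegree).coeff)

theorem map_mk_eq_zero_iff {K : Ideal A} {E : A[X]} :
    E.map (Ideal.Quotient.mk K) = 0 ↔ ∀ i, E.coeff i ∈ K := by
  simp [Polynomial.ext_iff, Ideal.Quotient.eq_zero_iff_mem]

theorem lowerIdeal_le_iff {K : Ideal A} {P : A[X]} :
    lowerIdeal P ≤ K ↔ P.map (Ideal.Quotient.mk K) = X ^ P.natDegree := by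
  rw [lowerIdeal, Ideal.span_le, Set.range_subset_iff, ← sub_eq_zero (b := X ^ _)]
  have := map_mk_eq_zero_iff (K := K) (E := P - X ^ P.natDegree)
  simpa only [Polynomial.map_sub, Polynomial.map_pow, Polynomial.map_X, SetLike.mem_coe] using
    this.symm

/-! ### Jacobian extensions with respect to arbitrary derivations -/

section Jacobian

variable {ι : Type*} (d : ι → Derivation ℤ A A)

/-- The ideal spanned by `J` and the minors of order `k` of the matrix of the derivatives of the
elements of `J` under the derivations `d c`. -/
def jacobianExtOf (k : ℕ) (J : Ideal A) : Ideal A :=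
  J ⊔ Ideal.span {x | ∃ (f : Fin k → A) (c : Fin k → ι), (∀ s, f s ∈ J) ∧
    x = (Matrix.of fun s t => d (c t) (f s)).det}

variable {d}

/-- Minors may be computed in any convenient directions: a matrix of derivatives along combinations
of the `d c` is the original Jacobian matrix times the matrix of coefficients. -/
theorem det_mem_jacobianExtOf [Fintype ι] {σ : Type*} [Fintype σ] [DecidableEq σ] {J : Ideal A}
    {f : σ → A} (hf : ∀ s, f s ∈ J) {D : σ → Derivation ℤ A A}
    (hD : ∀ t, D t ∈ Submodule.span A (Set.range d)) :
    (Matrix.of fun s t => D t (f s)).det ∈ jacobianExtOf d (Fintype.card σ) J := by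
  choose X hX using fun t => (Submodule.mem_span_range_iff_exists_fun A).1 (hD t)
  have h : (Matrix.of fun s t => D t (f s)) =
      (Matrix.of fun s c => d c (f s)) * (Matrix.of fun c t => X t c) := by
    ext s t
    rw [Matrix.mul_apply, Matrix.of_apply, ← hX t]
    refine (congrFun (map_sum (Derivation.coeFnAddMonoidHom (R := ℤ) (A := A) (M := A)) _ _)
      (f s)).trans ?_
    rw [Finset.sum_apply]
    exact Finset.sum_congr rfl fun c _ => mul_comm _ _
  rw [h, det_mul_eq_sum]
  refine Ideal.sum_mem _ fun c _ => Ideal.mul_mem_left _ _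
    (le_sup_right (a := J) (Ideal.subset_span ?_))
  let e := Fintype.equivFin σ
  refine ⟨f ∘ e.symm, c ∘ e.symm, fun s => hf _, ?_⟩
  rw [← Matrix.det_submatrix_equiv_self e.symm]
  rfl

theorem prod_mem_jacobianExtOf [Fintype ι] {σ : Type*} [Fintype σ] [DecidableEq σ] {J : Ideal A}
    {f : σ → A} (hf : ∀ s, f s ∈ J) {D : σ → Derivation ℤ A A}
    (hD : ∀ t, D t ∈ Submodule.span A (Set.range d)) (δ : σ → A)
    (h : ∀ s t, D t (f s) - Matrix.diagonal δ s t ∈ J) :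
    ∏ s, δ s ∈ jacobianExtOf d (Fintype.card σ) J := by
  have hdet : (Matrix.of fun s t => D t (f s)).det - (Matrix.diagonal δ).det ∈ J := by
    rw [← Ideal.Quotient.eq, RingHom.map_det, RingHom.map_det]
    congr 1
    ext s t
    exact Ideal.Quotient.eq.2 (h s t)
  rw [← Matrix.det_diagonal]
  have := Ideal.sub_mem _ (det_mem_jacobianExtOf hf hD) (Ideal.mem_sup_left hdet)
  rwa [sub_sub_cancel] at this

/-- A rank bound: modulo `K` every row of the Jacobian matrix is a combination of the fewer than `k`
fixed rows `N j`. -/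
theorem jacobianExtOf_le [Fintype ι] {e : Type*} [Fintype e] {J K : Ideal A} {k : ℕ}
    (hk : Fintype.card e < k) (hJK : J ≤ K) (N : e → ι → A)
    (h : ∀ φ ∈ J, ∃ X : e → A, ∀ c, d c φ - ∑ j, X j * N j c ∈ K) :
    jacobianExtOf d k J ≤ K := by
  refine sup_le hJK (Ideal.span_le.2 ?_)
  rintro _ ⟨f, c, hf, rfl⟩
  choose X hX using fun s => h (f s) (hf s)
  exact det_mem_of_sub_mul_mem _ (Matrix.of X) (Matrix.of fun j t => N j (c t))
    (by simpa using hk) fun s t => hX s (c t)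

end Jacobian

/-! ### The family of ideals attached to a pair of monic factors -/

section FactorSystem

variable {ι κ : Type*} [Fintype ι] [Fintype κ]

/-- The elements `H j` and the non-leading coefficients of the monic polynomials `f` and `g` behave
like a coordinate system with respect to the derivations `d`: they are as many as the derivations,
their derivatives along the span of the derivations can be prescribed, and they generate `m`. -/
structure IsFactorSystem (d : ι → Derivation ℤ A A) (m : Ideal A) (H : κ → A) (f g : A[X]) :
    Prop where
  monic_left : f.Monic
  monic_right : g.Monic
  card_eq : Fintype.card κ + f.natDegree + g.natDegree = Fintype.card ι
  submersive : ∀ (w : κ → A) (u v : A[X]), u.degree < f.natDegree → v.degree < g.natDegree →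
    ∃ D ∈ Submodule.span A (Set.range d),
      (∀ j, D (H j) = w j) ∧ coeffDer D f = u ∧ coeffDer D g = v
  span_eq : Ideal.span (Set.range H) ⊔ lowerIdeal f ⊔ lowerIdeal g = m

theorem IsFactorSystem.symm {d : ι → Derivation ℤ A A} {m : Ideal A} {H : κ → A} {f g : A[X]}
    (h : IsFactorSystem d m H f g) : IsFactorSystem d m H g f where
  monic_left := h.monic_right
  monic_right := h.monic_left
  card_eq := by rw [← h.card_eq]; omega
  submersive w u v hu hv := by
    obtain ⟨D, hD, h1, h2, h3⟩ := h.submersive w v u hv hu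
    exact ⟨D, hD, h1, h3, h2⟩
  span_eq := by rw [sup_right_comm, h.span_eq]

/-- The ideal generated by the `H j` and by the coefficients of `P - X ^ deg P` for
`P = f ^ (a + 1) * g ^ (b + 1)`. -/
noncomputable def factorIdeal (H : κ → A) (f g : A[X]) (a b : ℕ) : Ideal A :=
  Ideal.span (Set.range H) ⊔ lowerIdeal (f ^ (a + 1) * g ^ (b + 1))

omit [Fintype κ] in
theorem factorIdeal_comm (H : κ → A) (f g : A[X]) (a b : ℕ) :
    factorIdeal H f g a b = factorIdeal H g f b a := by
  rw [factorIdeal, factorIdeal, mul_comm]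

theorem coeffDer_pow_mul_pow (D : Derivation ℤ A A) (f g : A[X]) (a b : ℕ) :
    coeffDer D (f ^ (a + 1) * g ^ (b + 1)) = f ^ a * g ^ b *
      (((a + 1 : ℕ) : A[X]) * (g * coeffDer D f) + ((b + 1 : ℕ) : A[X]) * (f * coeffDer D g)) := by
  simp only [Derivation.leibniz, Derivation.leibniz_pow, smul_eq_mul, nsmul_eq_mul,
    Nat.add_sub_cancel]
  ring

theorem natDegree_pow_mul_pow {f g : A[X]} (hf : f.Monic) (hg : g.Monic) (a b : ℕ) :
    (f ^ a * g ^ b).natDegree = a * f.natDegree + b * g.natDegree := by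
  rw [(hf.pow a).natDegree_mul (hg.pow b), hf.natDegree_pow, hg.natDegree_pow]

variable {d : ι → Derivation ℤ A A} {m : Ideal A} {H : κ → A} {f g : A[X]}

theorem IsFactorSystem.factorIdeal_le (h : IsFactorSystem d m H f g) (a b : ℕ) :
    factorIdeal H f g a b ≤ m := by
  have hm := h.span_eq.le
  rw [sup_le_iff, sup_le_iff, lowerIdeal_le_iff, lowerIdeal_le_iff] at hm
  refine sup_le hm.1.1 (lowerIdeal_le_iff.2 ?_)
  rw [natDegree_pow_mul_pow h.monic_left h.monic_right, Polynomial.map_mul, Polynomial.map_pow,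
    Polynomial.map_pow, hm.1.2, hm.2]
  ring

/-- The quotient of `f ^ (a + 1) * g ^ (b + 1) - X ^ N` by `f ^ a * g ^ b`. -/
noncomputable def reducedQuot (f g : A[X]) (a b : ℕ) : A[X] :=
  (f ^ (a + 1) * g ^ (b + 1) - X ^ (f ^ (a + 1) * g ^ (b + 1)).natDegree) /ₘ (f ^ a * g ^ b)

omit [Fintype κ] in
theorem map_pow_mul_pow (H : κ → A) (f g : A[X]) (a b : ℕ) :
    (f ^ (a + 1) * g ^ (b + 1)).map (Ideal.Quotient.mk (factorIdeal H f g a b)) =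
      X ^ (f ^ (a + 1) * g ^ (b + 1)).natDegree :=
  lowerIdeal_le_iff.1 le_sup_right

omit [Fintype κ] in
theorem map_reducedQuot (hf : f.Monic) (hg : g.Monic) (a b : ℕ) :
    (reducedQuot f g a b).map (Ideal.Quotient.mk (factorIdeal H f g a b)) = 0 := by
  have h : (f ^ (a + 1) * g ^ (b + 1) - X ^ (f ^ (a + 1) * g ^ (b + 1)).natDegree).map
      (Ideal.Quotient.mk (factorIdeal H f g a b)) = 0 := by
    rw [Polynomial.map_sub, map_pow_mul_pow, Polynomial.map_pow, Polynomial.map_X, sub_self]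
  rw [reducedQuot, map_divByMonic _ ((hf.pow a).mul (hg.pow b)), h, zero_divByMonic]

omit [Fintype κ] in
-- The dividend vanishes modulo the ideal, so differentiation commutes with the division; the
-- derivative of the product carries the factor `f ^ a * g ^ b`, which cancels exactly.
theorem map_coeffDer_reducedQuot [Nontrivial A] (hf : f.Monic) (hg : g.Monic) (a b : ℕ)
    (D : Derivation ℤ A A) :
    (coeffDer D (reducedQuot f g a b)).map (Ideal.Quotient.mk (factorIdeal H f g a b)) =
      (((a + 1 : ℕ) : A[X]) * (g * coeffDer D f) + ((b + 1 : ℕ) : A[X]) * (f * coeffDer D g)).map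
        (Ideal.Quotient.mk (factorIdeal H f g a b)) := by
  have h : (f ^ (a + 1) * g ^ (b + 1) - X ^ (f ^ (a + 1) * g ^ (b + 1)).natDegree).map
      (Ideal.Quotient.mk (factorIdeal H f g a b)) = 0 := by
    rw [Polynomial.map_sub, map_pow_mul_pow, Polynomial.map_pow, Polynomial.map_X, sub_self]
  have hp := (hf.pow a).mul (hg.pow b)
  rw [reducedQuot, (map_coeffDer_divByMonic _ D hp h).1, map_sub, coeffDer_X_pow, sub_zero,
    coeffDer_pow_mul_pow,
    Polynomial.map_mul (p := f ^ a * g ^ b), mul_divByMonic_cancel_left _ (hp.map _)]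

theorem coeff_sub_mem_of_map_eq {K : Ideal A} {p q : A[X]} (h : p.map (Ideal.Quotient.mk K) =
    q.map (Ideal.Quotient.mk K)) (i : ℕ) : p.coeff i - q.coeff i ∈ K := by
  rw [← Ideal.Quotient.eq, ← coeff_map, ← coeff_map, h]

end FactorSystem

end Algebra

/-! ### One subtraction step of the Euclidean algorithm, and its end -/

section FactorStep

variable {A : Type*} [CommRing A] {ι κ : Type*} [Fintype ι] [Fintype κ]
  {d : ι → Derivation ℤ A A} {m : Ideal A} {H : κ → A} {f g : A[X]}

omit [Fintype κ] in
theorem map_coeffDer_reducedQuot_divByMonic [Nontrivial A] (hf : f.Monic) (hg : g.Monic)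
    (a b : ℕ) (D : Derivation ℤ A A) {u v : A[X]} (hv : v.degree < g.degree)
    (huv : ((a + 1 : ℕ) : A[X]) * (g * coeffDer D f) +
      ((b + 1 : ℕ) : A[X]) * (f * coeffDer D g) = v + g * u) :
    (coeffDer D (reducedQuot f g a b /ₘ g)).map (Ideal.Quotient.mk (factorIdeal H f g a b)) =
        u.map (Ideal.Quotient.mk (factorIdeal H f g a b)) ∧
      (coeffDer D (reducedQuot f g a b %ₘ g)).map (Ideal.Quotient.mk (factorIdeal H f g a b)) =
        v.map (Ideal.Quotient.mk (factorIdeal H f g a b)) := by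
  have h := map_coeffDer_divByMonic _ D hg (map_reducedQuot (H := H) hf hg a b)
  have h' := div_modByMonic_unique u v hg ⟨huv.symm, hv⟩
  rw [map_coeffDer_reducedQuot hf hg, ← map_divByMonic _ hg, ← map_modByMonic _ hg, h'.1, h'.2]
    at h
  exact h

/-- The rows are `H`, the coefficients of the quotient of `reducedQuot` by `g`, and one coefficient
of its remainder. Directions are chosen to make their Jacobian matrix diagonal modulo the ideal. -/
theorem IsFactorSystem.exists_diagonal [DecidableEq κ] [Nontrivial A]
    (h : IsFactorSystem d m H f g) (hQ : ∀ k : ℕ, IsUnit ((k + 1 : ℕ) : A))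
    (hr : 0 < g.natDegree) (a b j : ℕ) :
    ∃ (F : (κ ⊕ Fin f.natDegree) ⊕ Unit → A)
      (D : (κ ⊕ Fin f.natDegree) ⊕ Unit → Derivation ℤ A A),
      (∀ s, F s ∈ factorIdeal H f g a b) ∧ (∀ t, D t ∈ Submodule.span A (Set.range d)) ∧
      ∀ s t, D t (F s) - Matrix.diagonal (Sum.elim 1 fun _ => (f %ₘ g).coeff j) s t ∈
        factorIdeal H f g a b := by
  set J := factorIdeal H f g a b
  have hf := h.monic_left
  have hg := h.monic_right
  obtain ⟨α, hα⟩ := (hQ a).exists_left_inv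
  obtain ⟨β, hβ⟩ := (hQ b).exists_left_inv
  have hα' : ((a + 1 : ℕ) : A[X]) * C α = 1 := by
    rw [mul_comm, ← C_eq_natCast, ← C_mul, hα, C_1]
  have hβ' : ((b + 1 : ℕ) : A[X]) * C β = 1 := by
    rw [mul_comm, ← C_eq_natCast, ← C_mul, hβ, C_1]
  have hgd := degree_eq_natDegree hg.ne_zero
  have hq : (f /ₘ g).degree < f.natDegree := by
    rw [← degree_eq_natDegree hf.ne_zero]
    exact degree_divByMonic_lt _ _ hf.ne_zero (by rw [hgd]; exact_mod_cast hr)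
  have hmod : f %ₘ g = f - g * (f /ₘ g) := modByMonic_eq_sub_mul_div f g
  choose D₁ hD₁ hD₁H hD₁f hD₁g using fun i : κ => h.submersive (Pi.single i 1) 0 0
    (by simp) (by simp)
  -- With `Df = X ^ i / (a + 1)` and `Dg = 0` the reduced derivative is `g * X ^ i`: quotient `X ^
  -- i`, remainder zero.
  choose D₂ hD₂ hD₂H hD₂f hD₂g using fun i : Fin f.natDegree => h.submersive 0 (C α * X ^ (i : ℕ))
    0 ((degree_C_mul_X_pow_le _ _).trans_lt (by exact_mod_cast i.2))
    (by simp)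
  -- Here the reduced derivative is `f - g * (f /ₘ g)`, which is the remainder of `f` itself, with
  -- quotient zero. The constant `Dg` is admissible because `deg g > 0`.
  obtain ⟨D₃, hD₃, hD₃H, hD₃f, hD₃g⟩ := h.submersive 0 (- (C α * (f /ₘ g))) (C β)
    (by rw [degree_neg]; exact (smul_eq_C_mul (p := f /ₘ g) α ▸ degree_smul_le _ _).trans_lt hq)
    (degree_C_le.trans_lt (by exact_mod_cast hr))
  have e₁ : ∀ i, _ := fun i => map_coeffDer_reducedQuot_divByMonic (H := H) hf hg a b (D₁ i)
    (u := 0) (v := 0) (by rw [hgd]; simp) (by rw [hD₁f, hD₁g]; simp)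
  have e₂ : ∀ i, _ := fun i => map_coeffDer_reducedQuot_divByMonic (H := H) hf hg a b (D₂ i)
    (u := X ^ (i : ℕ)) (v := 0) (by rw [hgd]; simp)
    (by rw [hD₂f, hD₂g]; linear_combination g * X ^ (i : ℕ) * hα')
  have e₃ := map_coeffDer_reducedQuot_divByMonic (H := H) hf hg a b D₃
    (u := 0) (v := f %ₘ g) (degree_modByMonic_lt _ hg)
    (by rw [hD₃f, hD₃g, hmod]; linear_combination f * hβ' - g * (f /ₘ g) * hα')
  have hE := map_reducedQuot (H := H) hf hg a b
  have hE₁ : (reducedQuot f g a b /ₘ g).map (Ideal.Quotient.mk J) = 0 := by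
    rw [map_divByMonic _ hg, hE, zero_divByMonic]
  have hE₂ : (reducedQuot f g a b %ₘ g).map (Ideal.Quotient.mk J) = 0 := by
    rw [map_modByMonic _ hg, hE, zero_modByMonic]
  let F : (κ ⊕ Fin f.natDegree) ⊕ Unit → A :=
    Sum.elim (Sum.elim H fun i => (reducedQuot f g a b /ₘ g).coeff i)
      fun _ => (reducedQuot f g a b %ₘ g).coeff j
  let D : (κ ⊕ Fin f.natDegree) ⊕ Unit → Derivation ℤ A A :=
    Sum.elim (Sum.elim D₁ D₂) fun _ => D₃
  have hF : ∀ s, F s ∈ J := by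
    rintro ((i | i) | i)
    · exact Ideal.mem_sup_left (Ideal.subset_span ⟨i, rfl⟩)
    · exact map_mk_eq_zero_iff.1 hE₁ i
    · exact map_mk_eq_zero_iff.1 hE₂ j
  have hD : ∀ t, D t ∈ Submodule.span A (Set.range d) := by
    rintro ((i | i) | i)
    exacts [hD₁ i, hD₂ i, hD₃]
  refine ⟨F, D, hF, hD, ?_⟩
  have hco : ∀ {p q : A[X]} (i : ℕ) (x : A), p.map (Ideal.Quotient.mk J) =
      q.map (Ideal.Quotient.mk J) → q.coeff i = x → p.coeff i - x ∈ J := by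
    rintro p q i x h rfl
    exact coeff_sub_mem_of_map_eq h i
  have hz : ∀ {x y : A}, x = y → x - y ∈ J := by
    rintro x y rfl
    simp
  rintro ((s | s) | s) ((t | t) | t)
  · refine hz ?_
    simp [F, D, hD₁H, Matrix.diagonal_apply, Pi.single_apply]
  · refine hz ?_
    simp [F, D, hD₂H]
  · refine hz ?_
    simp [F, D, hD₃H]
  · exact hco (s : ℕ) _ (e₁ t).1 (by simp)
  · exact hco (s : ℕ) _ (e₂ t).1 (by simp [Matrix.diagonal_apply, coeff_X_pow, Fin.ext_iff])
  · exact hco (s : ℕ) _ e₃.1 (by simp)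
  · exact hco j _ (e₁ t).2 (by simp)
  · exact hco j _ (e₂ t).2 (by simp)
  · exact hco j _ e₃.2 (by simp)

theorem IsFactorSystem.jacobianExtOf_eq_top [Nontrivial A] (h : IsFactorSystem d m H f g)
    (hQ : ∀ k : ℕ, IsUnit ((k + 1 : ℕ) : A)) (hr : 0 < g.natDegree) (a b : ℕ) :
    jacobianExtOf d (Fintype.card κ + f.natDegree) (factorIdeal H f g a b) = ⊤ := by
  classical
  obtain ⟨F, D, hF, hD, hFD⟩ := h.exists_diagonal hQ hr a b 0
  have key := prod_mem_jacobianExtOf (fun s => hF (Sum.inl s)) (fun t => hD (Sum.inl t)) 1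
    fun s t => by simpa [Matrix.diagonal_apply] using hFD (Sum.inl s) (Sum.inl t)
  rw [Ideal.eq_top_iff_one]
  simpa using key

theorem IsFactorSystem.coeff_mem_jacobianExtOf [Nontrivial A] (h : IsFactorSystem d m H f g)
    (hQ : ∀ k : ℕ, IsUnit ((k + 1 : ℕ) : A)) (hr : 0 < g.natDegree) (a b j : ℕ) :
    (f %ₘ g).coeff j ∈
      jacobianExtOf d (Fintype.card κ + f.natDegree + 1) (factorIdeal H f g a b) := by
  classical
  obtain ⟨F, D, hF, hD, hFD⟩ := h.exists_diagonal hQ hr a b j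
  simpa using prod_mem_jacobianExtOf hF hD _ hFD

/-- The coordinates `H j` followed by the coefficients of the remainder of `f` modulo `g`. -/
noncomputable def addRemainder (H : κ → A) (f g : A[X]) : κ ⊕ Fin g.natDegree → A :=
  Sum.elim H fun j => (f %ₘ g).coeff j

omit [Fintype κ] in
theorem span_range_addRemainder_le_iff [Nontrivial A] (hg : g.Monic) {K : Ideal A} :
    Ideal.span (Set.range (addRemainder H f g)) ≤ K ↔
      Ideal.span (Set.range H) ≤ K ∧ (f %ₘ g).map (Ideal.Quotient.mk K) = 0 := by
  rw [addRemainder, Set.Sum.elim_range, Ideal.span_union, sup_le_iff, map_mk_eq_zero_iff]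
  refine and_congr_right fun _ => ?_
  rw [Ideal.span_le, Set.range_subset_iff]
  refine ⟨fun h i => ?_, fun h j => h j⟩
  by_cases hi : i < g.natDegree
  · exact h ⟨i, hi⟩
  · have := degree_modByMonic_lt f hg
    rw [degree_eq_natDegree hg.ne_zero, degree_lt_iff_coeff_zero] at this
    rw [this i (not_lt.1 hi)]
    exact K.zero_mem

theorem map_eq_mul_of_map_modByMonic_eq_zero {B : Type*} [CommRing B] {φ : A →+* B}
    (h : (f %ₘ g).map φ = 0) : f.map φ = g.map φ * (f /ₘ g).map φ := by
  conv_lhs => rw [← modByMonic_add_div f g]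
  rw [Polynomial.map_add, h, zero_add, Polynomial.map_mul]

theorem map_pow_mul_pow_divByMonic {B : Type*} [CommRing B] {φ : A →+* B}
    (h : (f %ₘ g).map φ = 0) (a b : ℕ) :
    ((f /ₘ g) ^ (a + 1) * g ^ (a + b + 1 + 1)).map φ = (f ^ (a + 1) * g ^ (b + 1)).map φ := by
  simp only [Polynomial.map_mul, Polynomial.map_pow, map_eq_mul_of_map_modByMonic_eq_zero h]
  ring

theorem monic_divByMonic [Nontrivial A] (hf : f.Monic) (hg : g.Monic)
    (h : g.natDegree ≤ f.natDegree) : (f /ₘ g).Monic := by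
  rw [Monic, leadingCoeff_divByMonic_of_monic hg, hf.leadingCoeff]
  rw [degree_eq_natDegree hf.ne_zero, degree_eq_natDegree hg.ne_zero]
  exact_mod_cast h

theorem natDegree_pow_mul_pow_divByMonic [Nontrivial A] (hf : f.Monic) (hg : g.Monic)
    (h : g.natDegree ≤ f.natDegree) (a b : ℕ) :
    ((f /ₘ g) ^ (a + 1) * g ^ (a + b + 1 + 1)).natDegree =
      (f ^ (a + 1) * g ^ (b + 1)).natDegree := by
  rw [natDegree_pow_mul_pow (monic_divByMonic hf hg h) hg, natDegree_pow_mul_pow hf hg,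
    natDegree_divByMonic f hg]
  obtain ⟨k, hk⟩ := Nat.exists_eq_add_of_le h
  rw [hk, Nat.add_sub_cancel_left]
  ring

theorem degree_mul_lt_of_natDegree_add_le {p u : A[X]} {k l : ℕ} (hu : u.degree < k)
    (h : p.natDegree + k ≤ l) : (p * u).degree < l := by
  by_cases h0 : u = 0
  · rw [h0, mul_zero, degree_zero]
    exact WithBot.bot_lt_coe _
  · rw [degree_eq_natDegree h0] at hu
    have hu' : u.natDegree < k := by exact_mod_cast hu
    refine (degree_le_of_natDegree_le natDegree_mul_le).trans_lt ?_
    exact_mod_cast (by omega : p.natDegree + u.natDegree < l)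

/-- Each coefficient of `p * E` depends linearly on the `n` coefficients of `E`; this is the source
of the rank bound. -/
theorem coeff_mul_eq_sum_fin {p E : A[X]} {n : ℕ} (hE : E.degree < n) (l : ℕ) :
    (p * E).coeff l = ∑ j : Fin n, (p * X ^ (j : ℕ)).coeff l * E.coeff j := by
  conv_lhs => rw [← sum_C_mul_X_pow_eq E, ← sum_fin _ (by simp) hE]
  rw [Finset.mul_sum, finsetSum_coeff]
  refine Finset.sum_congr rfl fun j _ => ?_
  rw [mul_left_comm, coeff_C_mul, mul_comm]

/-- The factor ideal obtained by dividing `f` by `g` and adding the coefficients of the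
remainder. -/
noncomputable def nextFactorIdeal (H : κ → A) (f g : A[X]) (a b : ℕ) : Ideal A :=
  factorIdeal (addRemainder H f g) (f /ₘ g) g a (a + b + 1)

omit [Fintype κ] in
theorem map_modByMonic_nextFactorIdeal [Nontrivial A] (hg : g.Monic) (a b : ℕ) :
    (f %ₘ g).map (Ideal.Quotient.mk (nextFactorIdeal H f g a b)) = 0 :=
  ((span_range_addRemainder_le_iff (H := H) hg).1 le_sup_left).2

omit [Fintype κ] in
theorem factorIdeal_le_nextFactorIdeal [Nontrivial A] (hf : f.Monic) (hg : g.Monic)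
    (hfg : g.natDegree ≤ f.natDegree) (a b : ℕ) :
    factorIdeal H f g a b ≤ nextFactorIdeal H f g a b := by
  refine sup_le ((span_range_addRemainder_le_iff (H := H) hg).1 le_sup_left).1
    (lowerIdeal_le_iff.2 ?_)
  rw [← map_pow_mul_pow_divByMonic (map_modByMonic_nextFactorIdeal hg a b),
    ← natDegree_pow_mul_pow_divByMonic hf hg hfg]
  exact map_pow_mul_pow _ _ _ _ _

theorem jacobianExtOf_le_nextFactorIdeal [Nontrivial A] (d : ι → Derivation ℤ A A)
    (hf : f.Monic) (hg : g.Monic) (hfg : g.natDegree ≤ f.natDegree) (a b : ℕ) :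
    jacobianExtOf d (Fintype.card κ + f.natDegree + 1) (factorIdeal H f g a b) ≤
      nextFactorIdeal H f g a b := by
  have hJK := factorIdeal_le_nextFactorIdeal (H := H) hf hg hfg a b
  have hmul := map_eq_mul_of_map_modByMonic_eq_zero
    (map_modByMonic_nextFactorIdeal (H := H) (f := f) hg a b)
  set K := nextFactorIdeal H f g a b
  -- Modulo `K`, where `f = g * (f /ₘ g)`, the derivative of `f ^ (a + 1) * g ^ (b + 1)` along `d c`
  -- is `f ^ a * g ^ b * g * E c`.
  let E : ι → A[X] := fun c => ((a + 1 : ℕ) : A[X]) * coeffDer (d c) f +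
    ((b + 1 : ℕ) : A[X]) * ((f /ₘ g) * coeffDer (d c) g)
  have hcast : ∀ (k n : ℕ) (p : A[X]), p.degree < n → ((k : A[X]) * p).degree < n :=
    fun k n p hp => degree_mul_lt_of_natDegree_add_le hp (by simp)
  have hE : ∀ c, (E c).degree < f.natDegree := fun c =>
    (degree_add_le _ _).trans_lt (max_lt (hcast _ _ _ (degree_coeffDer_lt _ hf))
      (hcast _ _ _ (degree_mul_lt_of_natDegree_add_le (degree_coeffDer_lt _ hg)
        (by rw [natDegree_divByMonic f hg]; omega))))
  refine jacobianExtOf_le (e := κ ⊕ Fin f.natDegree) (by simp) hJK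
    (Sum.elim (fun j c => d c (H j)) fun i c => (E c).coeff i) ?_
  classical
  intro φ hφ
  rw [factorIdeal, lowerIdeal, ← Ideal.span_union] at hφ
  induction hφ using Submodule.span_induction with
  | mem x hx =>
    rcases hx with ⟨j, rfl⟩ | ⟨l, rfl⟩
    · exact ⟨Pi.single (Sum.inl j) 1, fun c => by simp [Pi.single_apply]⟩
    · refine ⟨Sum.elim 0 fun i => (f ^ a * g ^ b * g * X ^ (i : ℕ)).coeff l, fun c => ?_⟩
      have h := coeff_mul_eq_sum_fin (p := f ^ a * g ^ b * g) (hE c) l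
      simp only [Fintype.sum_sum_type, Sum.elim_inl, Sum.elim_inr, Pi.zero_apply, zero_mul,
        Finset.sum_const_zero, zero_add, ← h, ← coeff_coeffDer, map_sub, coeffDer_X_pow, sub_zero,
        coeffDer_pow_mul_pow]
      refine coeff_sub_mem_of_map_eq ?_ l
      simp only [E, Polynomial.map_mul, Polynomial.map_add, hmul]
      ring
  | zero => exact ⟨0, by simp⟩
  | add x y _ _ hx hy =>
    obtain ⟨X, hX⟩ := hx
    obtain ⟨Y, hY⟩ := hy
    refine ⟨X + Y, fun c => ?_⟩
    convert K.add_mem (hX c) (hY c) using 1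
    simp only [map_add, Pi.add_apply, add_mul, Finset.sum_add_distrib]
    ring
  -- By Leibniz `d c (r * x)` is `r * d c x + x * d c r`, and the second term lies in `K` because
  -- `x` does.
  | smul r x hx' hx =>
    obtain ⟨X, hX⟩ := hx
    refine ⟨r • X, fun c => ?_⟩
    have hxK : x ∈ K := hJK (by rwa [factorIdeal, lowerIdeal, ← Ideal.span_union])
    convert K.add_mem (K.mul_mem_left r (hX c)) (K.mul_mem_right (d c r) hxK) using 1
    simp only [smul_eq_mul, Derivation.leibniz, Pi.smul_apply, mul_sub, Finset.mul_sum, mul_assoc]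
    ring

theorem IsFactorSystem.jacobianExtOf_eq [Nontrivial A] (h : IsFactorSystem d m H f g)
    (hQ : ∀ k : ℕ, IsUnit ((k + 1 : ℕ) : A)) (hr : 0 < g.natDegree)
    (hfg : g.natDegree ≤ f.natDegree) (a b : ℕ) :
    jacobianExtOf d (Fintype.card κ + f.natDegree + 1) (factorIdeal H f g a b) =
      nextFactorIdeal H f g a b := by
  have hf := h.monic_left
  have hg := h.monic_right
  refine le_antisymm (jacobianExtOf_le_nextFactorIdeal d hf hg hfg a b) ?_
  have hJL : factorIdeal H f g a b ≤
      jacobianExtOf d (Fintype.card κ + f.natDegree + 1) (factorIdeal H f g a b) := le_sup_left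
  have hmod := map_mk_eq_zero_iff.2 (h.coeff_mem_jacobianExtOf hQ hr a b)
  refine sup_le ((span_range_addRemainder_le_iff hg).2 ⟨le_sup_left.trans hJL, hmod⟩)
    (lowerIdeal_le_iff.2 ?_)
  rw [map_pow_mul_pow_divByMonic hmod, natDegree_pow_mul_pow_divByMonic hf hg hfg]
  exact lowerIdeal_le_iff.1 (le_sup_right.trans hJL)

/-- For fixed monic `g`, division with remainder is an invertible change of coordinates from `f` to
the pair (remainder, quotient). -/
theorem IsFactorSystem.divByMonic [Nontrivial A] (h : IsFactorSystem d m H f g)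
    (hfg : g.natDegree ≤ f.natDegree) :
    IsFactorSystem d m (addRemainder H f g) (f /ₘ g) g where
  monic_left := monic_divByMonic h.monic_left h.monic_right hfg
  monic_right := h.monic_right
  card_eq := by
    rw [natDegree_divByMonic f h.monic_right, Fintype.card_sum, Fintype.card_fin, ← h.card_eq]
    omega
  submersive w u v hu hv := by
    have hg := h.monic_right
    have hgd := degree_eq_natDegree hg.ne_zero
    have hqd := natDegree_divByMonic f hg
    let W : A[X] := ∑ j : Fin g.natDegree, C (w (Sum.inr j)) * X ^ (j : ℕ)
    have hW : W.degree < g.natDegree := degree_sum_fin_lt _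
    -- The value of `Df` is forced by differentiating `f = R + g * q` with the prescribed `DR = W`,
    -- `Dq = u`, `Dg = v`.
    obtain ⟨D, hD, hDH, hDf, hDg⟩ := h.submersive (fun j => w (Sum.inl j))
      (W + (g * u + (f /ₘ g) * v)) v
      (by
        refine (degree_add_le _ _).trans_lt (max_lt (hW.trans_le (by exact_mod_cast hfg))
          ((degree_add_le _ _).trans_lt (max_lt ?_ ?_)))
        · exact degree_mul_lt_of_natDegree_add_le hu (by omega)
        · exact degree_mul_lt_of_natDegree_add_le hv (by omega)) hv
    have h₁ : coeffDer D (f %ₘ g) + g * coeffDer D (f /ₘ g) = W + g * u := by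
      have := congrArg (coeffDer D) (modByMonic_add_div f g)
      rw [hDf, map_add, Derivation.leibniz, smul_eq_mul, smul_eq_mul, hDg] at this
      linear_combination this
    have h₂ := div_modByMonic_unique (coeffDer D (f /ₘ g)) (coeffDer D (f %ₘ g)) hg
      ⟨h₁, by rw [hgd]; exact degree_coeffDer_lt_of_lt D (hgd ▸ degree_modByMonic_lt f hg)⟩
    have h₃ := div_modByMonic_unique u W hg ⟨rfl, hgd ▸ hW⟩
    refine ⟨D, hD, ?_, h₂.1.symm.trans h₃.1, hDg⟩
    rintro (j | j)
    · exact hDH j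
    · rw [addRemainder, Sum.elim_inr, ← coeff_coeffDer, ← h₂.2, h₃.2]
      simp [W, finsetSum_coeff, coeff_C_mul, coeff_X_pow, Fin.val_inj]
  span_eq := by
    have hf := h.monic_left
    have hg := h.monic_right
    have hqd := natDegree_divByMonic f hg
    have hX : (X : (A ⧸ m)[X]) ^ f.natDegree =
        X ^ g.natDegree * X ^ (f.natDegree - g.natDegree) := by
      rw [← pow_add, Nat.add_sub_cancel' hfg]
    apply le_antisymm
    · have hm := h.span_eq.le
      rw [sup_le_iff, sup_le_iff, lowerIdeal_le_iff, lowerIdeal_le_iff] at hm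
      refine sup_le (sup_le ((span_range_addRemainder_le_iff hg).2 ⟨hm.1.1, ?_⟩)
        (lowerIdeal_le_iff.2 ?_)) (lowerIdeal_le_iff.2 hm.2)
      · rw [map_modByMonic _ hg, hm.1.2, hm.2, hX, self_mul_modByMonic (monic_X_pow _)]
      · rw [map_divByMonic _ hg, hm.1.2, hm.2, hX, mul_divByMonic_cancel_left _ (monic_X_pow _),
          hqd]
    · obtain ⟨I, hI⟩ : ∃ I, Ideal.span (Set.range (addRemainder H f g)) ⊔ lowerIdeal (f /ₘ g) ⊔
        lowerIdeal g = I := ⟨_, rfl⟩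
      rw [hI]
      replace hI := hI.le
      rw [sup_le_iff, sup_le_iff, span_range_addRemainder_le_iff hg, lowerIdeal_le_iff,
        lowerIdeal_le_iff] at hI
      rw [← h.span_eq]
      refine sup_le (sup_le hI.1.1.1 (lowerIdeal_le_iff.2 ?_)) (lowerIdeal_le_iff.2 hI.2)
      rw [map_eq_mul_of_map_modByMonic_eq_zero hI.1.1.2, hI.1.2, hI.2, hqd, ← pow_add,
        Nat.add_sub_cancel' hfg]

/-- Differentiating and multiplying by `X * F` gives the Euler equation `X * F' = n * F`, after
cancelling `a + 1` and a power of `X`. Comparing coefficients, `(i - n) * F_i = 0`, and nonzero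
integers are units. -/
theorem eq_X_pow_of_pow_eq_X_pow {B : Type*} [CommRing B]
    (hQ : ∀ k : ℕ, IsUnit ((k + 1 : ℕ) : B)) {F : B[X]} {n a : ℕ} (hF : F.coeff n = 1)
    (h : F ^ (a + 1) = X ^ ((a + 1) * n)) : F = X ^ n := by
  have hX : X * derivative F = (n : B[X]) * F := by
    have h' := congrArg derivative h
    rw [derivative_pow, derivative_X_pow, Nat.add_sub_cancel] at h'
    have hu : IsUnit ((a + 1 : ℕ) : B[X]) := by
      rw [← C_eq_natCast]
      exact (hQ a).map C
    refine hu.mul_left_cancel ((monic_X_pow ((a + 1) * n)).isRegular.left ?_)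
    -- For `n = 0` the exponent `(a + 1) * n - 1` is truncated, so this case is separate.
    rcases Nat.eq_zero_or_pos n with rfl | hn
    · simp only [C_eq_natCast] at h'
      simp at h' h ⊢
      linear_combination X * F * h' - (a + 1) * X * derivative F * h
    · have hp : (X : B[X]) ^ ((a + 1) * n) = X ^ ((a + 1) * n - 1) * X := by
        rw [← pow_succ, Nat.sub_add_cancel (Nat.mul_pos a.succ_pos hn)]
      simp only [C_eq_natCast] at h'
      push_cast at h' ⊢
      linear_combination X * F * h' - (a + 1) * X * derivative F * h - (a + 1) * n * F * hp
  ext i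
  rw [coeff_X_pow]
  split_ifs with hi
  · rw [hi, hF]
  · have hc : (i : B) * F.coeff i = n * F.coeff i := by
      have := congrArg (fun p => coeff p i) hX
      simp only [← C_eq_natCast, coeff_C_mul] at this
      rw [← this]
      cases i with
      | zero => simp
      | succ i => rw [coeff_X_mul, coeff_derivative]; push_cast; ring
    rcases lt_or_gt_of_ne hi with hlt | hlt
    · obtain ⟨k, rfl⟩ := Nat.exists_eq_add_of_lt hlt
      refine (hQ k).mul_left_cancel ?_
      push_cast at hc ⊢
      linear_combination -hc
    · obtain ⟨k, rfl⟩ := Nat.exists_eq_add_of_lt hlt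
      refine (hQ k).mul_left_cancel ?_
      push_cast at hc ⊢
      linear_combination hc

theorem IsFactorSystem.factorIdeal_eq (h : IsFactorSystem d m H f g)
    (hQ : ∀ k : ℕ, IsUnit ((k + 1 : ℕ) : A)) (hr : g.natDegree = 0) (a b : ℕ) :
    factorIdeal H f g a b = m := by
  refine le_antisymm (h.factorIdeal_le a b) ?_
  obtain rfl := h.monic_right.natDegree_eq_zero.1 hr
  rw [← h.span_eq]
  refine sup_le (sup_le le_sup_left (lowerIdeal_le_iff.2 ?_)) (lowerIdeal_le_iff.2 (by simp))
  refine eq_X_pow_of_pow_eq_X_pow (a := a) (fun k => ?_) ?_ ?_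
  · simpa using (hQ k).map (Ideal.Quotient.mk (factorIdeal H f 1 a b))
  · rw [coeff_map, h.monic_left.coeff_natDegree, map_one]
  · have := map_pow_mul_pow H f 1 a b
    rw [natDegree_pow_mul_pow h.monic_left h.monic_right] at this
    simpa using this

end FactorStep

/-! ### Monic polynomials with given lower coefficients -/

section MonicOf

variable {A : Type*} [CommRing A]

/-- The monic polynomial of degree `n` with non-leading coefficients `y`. -/
noncomputable def monicOf {n : ℕ} (y : Fin n → A) : A[X] :=
  X ^ n + ∑ i : Fin n, C (y i) * X ^ (i : ℕ)

theorem map_monicOf {B : Type*} [CommRing B] (φ : A →+* B) {n : ℕ} (y : Fin n → A) :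
    (monicOf y).map φ = monicOf fun i => φ (y i) := by
  simp [monicOf, Polynomial.map_sum]

theorem monic_monicOf {n : ℕ} (y : Fin n → A) : (monicOf y).Monic :=
  monic_X_pow_add (degree_sum_fin_lt _)

theorem natDegree_monicOf [Nontrivial A] {n : ℕ} (y : Fin n → A) :
    (monicOf y).natDegree = n := by
  rw [monicOf, natDegree_add_eq_left_of_degree_lt, natDegree_X_pow]
  rw [degree_X_pow]
  exact degree_sum_fin_lt _

theorem lowerIdeal_monicOf [Nontrivial A] {n : ℕ} (y : Fin n → A) :
    lowerIdeal (monicOf y) = Ideal.span (Set.range y) := by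
  have hs : monicOf y - X ^ (monicOf y).natDegree = ∑ i : Fin n, C (y i) * X ^ (i : ℕ) := by
    rw [natDegree_monicOf, monicOf, add_sub_cancel_left]
  rw [lowerIdeal, hs]
  refine le_antisymm (Ideal.span_le.2 ?_) (Ideal.span_mono ?_)
  · rintro _ ⟨i, rfl⟩
    rw [finsetSum_coeff]
    refine Ideal.sum_mem _ fun j _ => ?_
    rw [coeff_C_mul]
    exact Ideal.mul_mem_right _ _ (Ideal.subset_span ⟨j, rfl⟩)
  · rintro _ ⟨j, rfl⟩
    exact ⟨j, by simp [finsetSum_coeff, coeff_X_pow, Fin.val_inj]⟩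

theorem coeffDer_monicOf (D : Derivation ℤ A A) {n : ℕ} (y : Fin n → A) :
    coeffDer D (monicOf y) = ∑ i : Fin n, C (D (y i)) * X ^ (i : ℕ) := by
  rw [monicOf, map_add, coeffDer_X_pow, zero_add]
  ext i
  simp only [coeff_coeffDer, finsetSum_coeff, coeff_C_mul, coeff_X_pow, map_sum]
  refine Finset.sum_congr rfl fun j _ => ?_
  split_ifs <;> simp

end MonicOf

/-! ### Germs: coordinates generate the maximal ideal, and partial derivatives are derivations -/

section Germs

variable {ι : Type} [Fintype ι]

instance : Nontrivial (germAlgebra ι) :=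
  ((Germ.valueRingHom (X := ι → ℂ) (E := ℂ) (x := 0)).comp
    (germAlgebra ι).subtype).domain_nontrivial

theorem maxIdeal_ne_top : maxIdeal ι ≠ ⊤ :=
  RingHom.ker_ne_top _

theorem isUnit_natCast_succ (k : ℕ) : IsUnit ((k + 1 : ℕ) : germAlgebra ι) := by
  refine IsUnit.of_mul_eq_one
    (germOf (fun _ => ((k + 1 : ℕ) : ℂ)⁻¹) analyticAt_const) (Subtype.ext ?_)
  have h : ((k + 1 : ℕ) : Germ (𝓝 (0 : ι → ℂ)) ℂ) = ((fun _ => ((k + 1 : ℕ) : ℂ) : (ι → ℂ) → ℂ) :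
    Germ (𝓝 (0 : ι → ℂ)) ℂ) := rfl
  push_cast [germOf] at h ⊢
  rw [h, ← Germ.coe_mul]
  refine congrArg _ (funext fun _ => ?_)
  exact mul_inv_cancel₀ (Nat.cast_add_one_ne_zero k)

/-- The germ of the `i`-th coordinate function. -/
noncomputable def coordGerm (i : ι) : germAlgebra ι :=
  germOf (fun p => p i)
    ((ContinuousLinearMap.proj (R := ℂ) (φ := fun _ : ι => ℂ) i).analyticAt 0)

/-- Hadamard's lemma: the germs of the coordinates generate the maximal ideal. -/
theorem span_range_coordGerm : Ideal.span (Set.range (coordGerm (ι := ι))) = maxIdeal ι := by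
  classical
  refine le_antisymm (Ideal.span_le.2 ?_) ?_
  · rintro _ ⟨i, rfl⟩
    rfl
  · rintro ⟨_, f, hf, rfl⟩ hφ
    have hf0 : f 0 = 0 := hφ
    obtain ⟨p, hp⟩ := hf
    have hrad : 0 < p.shift.radius := by
      rw [p.radius_shift]
      exact hp.radius_pos
    have hsum := p.shift.hasFPowerSeriesOnBall hrad
    have hp' := (hsum.unshift (z := (0 : ℂ))).hasFPowerSeriesAt
    -- Since `f 0 = 0`, the series has no constant term, so near `0` the value `f y` is the linear
    -- form `p.shift.sum y` applied to `y`. Expanding `y` in the standard basis gives the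
    -- factorization.
    have heq : p.shift.unshift 0 = p := by
      ext n v
      cases n with
      | zero =>
        rw [hp.coeff_zero, hf0]
        rfl
      | succ n =>
        simp [FormalMultilinearSeries.unshift, FormalMultilinearSeries.shift]
    rw [heq] at hp'
    have hev : f =ᶠ[𝓝 0] fun y => ∑ i, p.shift.sum y (Pi.single i 1) * y i := by
      filter_upwards [hp.eventually_hasSum, hp'.eventually_hasSum] with y h₁ h₂
      rw [zero_add] at h₁ h₂
      rw [h₁.unique h₂, zero_add, sub_zero]
      refine (congrArg (p.shift.sum y) (pi_eq_sum_univ' y)).trans ?_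
      simp [mul_comm]
    have hg : ∀ i : ι, AnalyticAt ℂ (fun y => p.shift.sum y (Pi.single i 1)) 0 := fun i =>
      ((ContinuousLinearMap.apply ℂ ℂ (Pi.single i (1 : ℂ) : ι → ℂ)).analyticAt _).comp
        hsum.analyticAt
    have hφ' : (⟨(f : Germ (𝓝 (0 : ι → ℂ)) ℂ), f, ⟨p, hp⟩, rfl⟩ : germAlgebra ι) =
        ∑ i, germOf _ (hg i) * coordGerm i := by
      refine Subtype.ext ?_
      rw [AddSubmonoidClass.coe_finsetSum]
      refine (Germ.coe_eq.2 hev).trans ?_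
      have := map_sum (Germ.coeRingHom (𝓝 (0 : ι → ℂ)))
        (fun i y => p.shift.sum y (Pi.single i 1) * y i) Finset.univ
      refine Eq.trans ?_ this
      refine congrArg _ (funext fun y => ?_)
      simp
    rw [hφ']
    exact Ideal.sum_mem _ fun i _ => Ideal.mul_mem_left _ _ (Ideal.subset_span ⟨i, rfl⟩)

variable [DecidableEq ι]

/-- The partial derivatives of germs as derivations. -/
noncomputable def partialDer (i : ι) : Derivation ℤ (germAlgebra ι) (germAlgebra ι) :=
  Derivation.mk' (AddMonoidHom.mk' (partialGerm i) (by
    rintro ⟨_, f, hf, rfl⟩ ⟨_, g, hg, rfl⟩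
    refine Subtype.ext (Germ.coe_eq.2 ?_)
    filter_upwards [hf.eventually_analyticAt, hg.eventually_analyticAt] with x hfx hgx
    simp only [partialFun]
    rw [fderiv_fun_add hfx.differentiableAt hgx.differentiableAt]
    rfl)).toIntLinearMap (by
    rintro ⟨_, f, hf, rfl⟩ ⟨_, g, hg, rfl⟩
    refine Subtype.ext (Germ.coe_eq.2 ?_)
    filter_upwards [hf.eventually_analyticAt, hg.eventually_analyticAt] with x hfx hgx
    simp only [partialFun]
    rw [fderiv_fun_mul hfx.differentiableAt hgx.differentiableAt]
    rfl)

theorem jacobianExt_eq (k : ℕ) (J : Ideal (germAlgebra ι)) :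
    jacobianExt k J = jacobianExtOf partialDer k J :=
  rfl

theorem partialDer_coordGerm (i j : ι) :
    partialDer i (coordGerm j) = if i = j then 1 else 0 := by
  have h : partialFun i (fun p : ι → ℂ => p j) = fun _ => if i = j then 1 else 0 := by
    funext x
    have := (ContinuousLinearMap.proj (R := ℂ) (φ := fun _ : ι => ℂ) j).fderiv (x := x)
    simp only [partialFun]
    refine (congrArg (fun L : (ι → ℂ) →L[ℂ] ℂ => L (Pi.single i 1)) this).trans ?_
    simp [Pi.single_apply, eq_comm]
  refine Subtype.ext ((congrArg (Germ.ofFun (l := 𝓝 (0 : ι → ℂ))) h).trans ?_)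
  split_ifs <;> rfl

theorem exists_partialDer_coordGerm (w : ι → germAlgebra ι) :
    ∃ D ∈ Submodule.span (germAlgebra ι) (Set.range (partialDer (ι := ι))),
      ∀ i, D (coordGerm i) = w i := by
  refine ⟨∑ k, w k • partialDer k, Submodule.sum_mem _ fun k _ => Submodule.smul_mem _ _
    (Submodule.subset_span ⟨k, rfl⟩), fun i => ?_⟩
  refine (congrFun (map_sum (Derivation.coeFnAddMonoidHom (R := ℤ) (A := germAlgebra ι)
    (M := germAlgebra ι)) _ _) (coordGerm i)).trans ?_
  rw [Finset.sum_apply]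
  refine (Finset.sum_congr rfl fun k _ => congrArg (w k * ·) (partialDer_coordGerm k i)).trans ?_
  simp

end Germs

/-! ### The Euclidean tuple by single subtractions -/

section EuclidTuple

theorem euclidTuple_zero_right (n : ℕ) : euclidTuple n 0 = [] := by
  rw [euclidTuple]

/-- The first quotient is zero, so this round of the algorithm only swaps the two numbers. -/
theorem euclidTuple_of_lt {n r : ℕ} (h : n < r) : euclidTuple n r = euclidTuple r n := by
  obtain ⟨r, rfl⟩ := Nat.exists_eq_succ_of_ne_zero (Nat.ne_zero_of_lt h)
  rw [euclidTuple, Nat.div_eq_of_lt h, Nat.mod_eq_of_lt h]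
  simp

theorem euclidTuple_of_le {n r : ℕ} (hr : 0 < r) (h : r ≤ n) :
    euclidTuple n r = r :: euclidTuple (n - r) r := by
  obtain ⟨r, rfl⟩ := Nat.exists_eq_succ_of_ne_zero hr.ne'
  rw [euclidTuple, euclidTuple, Nat.div_eq_sub_div hr h, List.replicate_succ,
    ← Nat.mod_eq_sub_mod h]
  simp

end EuclidTuple

/-! ### The symbol of the whole family, by induction on the total degree -/

section Symbol

variable {ι : Type} [Fintype ι] [DecidableEq ι]

theorem IsFactorSystem.isTBSymbol {n : ℕ} {κ : Type} [Fintype κ] {H : κ → germAlgebra ι}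
    {f g : (germAlgebra ι)[X]} (h : IsFactorSystem partialDer (maxIdeal ι) H f g) (a b : ℕ)
    (hn : f.natDegree + g.natDegree = n) :
    IsTBSymbol (euclidTuple f.natDegree g.natDegree) (factorIdeal H f g a b) := by
  induction n using Nat.strong_induction_on generalizing κ f g a b with
  | _ n ih =>
    -- The ideal is symmetric in the two factors, and the tuple obeys the same swap.
    wlog hfg : g.natDegree ≤ f.natDegree generalizing f g a b
    · rw [euclidTuple_of_lt (not_le.1 hfg), factorIdeal_comm]
      exact this h.symm b a (by omega) (not_le.1 hfg).le
    have hQ := isUnit_natCast_succ (ι := ι)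
    rcases Nat.eq_zero_or_pos g.natDegree with hr | hr
    · rw [hr, euclidTuple_zero_right]
      exact h.factorIdeal_eq hQ hr a b
    have hnext := h.divByMonic hfg
    have hqd := natDegree_divByMonic f h.monic_right
    have hle : nextFactorIdeal H f g a b ≤ maxIdeal ι := hnext.factorIdeal_le _ _
    have hc := h.card_eq
    have hcard : Fintype.card ι - g.natDegree + 1 = Fintype.card κ + f.natDegree + 1 := by omega
    have hext : upperExt g.natDegree (factorIdeal H f g a b) = nextFactorIdeal H f g a b := by
      rw [upperExt, hcard, jacobianExt_eq]
      exact h.jacobianExtOf_eq hQ hr hfg a b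
    have hne : jacobianExt (Fintype.card ι - g.natDegree + 1) (factorIdeal H f g a b) ≠ ⊤ := by
      intro htop
      rw [upperExt, htop] at hext
      exact maxIdeal_ne_top (top_le_iff.1 (hext.le.trans hle))
    rw [euclidTuple_of_le hr hfg]
    refine ⟨?_, by omega, ⟨hne, ?_⟩, ?_⟩
    -- For the maximal ideal, the coordinates have identity Jacobian matrix, so the extension of
    -- order `Fintype.card ι` is everything. As `g.natDegree ≥ 1`, the order considered here is no
    -- larger, contradicting properness.
    · intro heq
      refine hne (top_le_iff.1 (le_trans ?_ (jacobianExt_antitone _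
        (by omega : Fintype.card ι - g.natDegree + 1 ≤ Fintype.card ι))))
      rw [top_le_iff, Ideal.eq_top_iff_one, heq]
      change 1 ∈ jacobianExtOf partialDer _ _
      choose D hD hDx using fun k : ι => exists_partialDer_coordGerm (Pi.single k 1)
      have hx : ∀ i : ι, coordGerm i ∈ maxIdeal ι := fun i => rfl
      simpa using prod_mem_jacobianExtOf hx hD 1 fun s t => by
        simp [hDx, Matrix.diagonal_apply, Pi.single_apply]
    · rw [hcard, Nat.add_sub_cancel, jacobianExt_eq]
      exact h.jacobianExtOf_eq_top hQ hr a b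
    · rw [hext, ← hqd]
      exact ih _ (by omega) hnext a (a + b + 1) rfl

end Symbol

/-! ### The multiplication map as the initial member of the family -/

section MulMap

variable (n r : ℕ)

theorem isFactorSystem_coordGerm :
    IsFactorSystem partialDer (maxIdeal (Fin n ⊕ Fin r)) (isEmptyElim : Empty → _)
      (monicOf fun i : Fin n => coordGerm (Sum.inl i : Fin n ⊕ Fin r))
      (monicOf fun i : Fin r => coordGerm (Sum.inr i : Fin n ⊕ Fin r)) where
  monic_left := monic_monicOf _
  monic_right := monic_monicOf _
  card_eq := by simp [natDegree_monicOf]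
  submersive w u v hu hv := by
    rw [natDegree_monicOf] at hu hv
    obtain ⟨D, hD, hDx⟩ := exists_partialDer_coordGerm (ι := Fin n ⊕ Fin r)
      (Sum.elim (fun i => u.coeff i) fun i => v.coeff i)
    refine ⟨D, hD, isEmptyElim, ?_, ?_⟩
    · simp only [coeffDer_monicOf, hDx, Sum.elim_inl]
      rw [sum_fin (fun i c => C c * X ^ i) (by simp) hu, sum_C_mul_X_pow_eq]
    · simp only [coeffDer_monicOf, hDx, Sum.elim_inr]
      rw [sum_fin (fun i c => C c * X ^ i) (by simp) hv, sum_C_mul_X_pow_eq]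
  span_eq := by
    rw [lowerIdeal_monicOf, lowerIdeal_monicOf, Set.range_eq_empty, Ideal.span_empty, bot_sup_eq,
      ← Ideal.span_union, ← span_range_coordGerm]
    congr 1
    ext x
    simp

/-- Both sides come from one polynomial over the ring of all functions: taking germs of its
coefficients gives the left side, evaluating them at points the right. -/
theorem coe_coeff_monicOf_mul (j : ℕ) :
    (germAlgebra (Fin n ⊕ Fin r)).subtype
      (((monicOf fun i : Fin n => coordGerm (Sum.inl i : Fin n ⊕ Fin r)) *
        (monicOf fun i : Fin r => coordGerm (Sum.inr i : Fin n ⊕ Fin r))).coeff j) =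
    Germ.coeRingHom (𝓝 (0 : Fin n ⊕ Fin r → ℂ)) fun p =>
      (monicPoly (fun i => p (Sum.inl i)) * monicPoly (fun i => p (Sum.inr i))).coeff j := by
  let F : ((Fin n ⊕ Fin r → ℂ) → ℂ)[X] :=
    (monicOf fun i p => p (Sum.inl i)) * monicOf fun i p => p (Sum.inr i)
  have h₁ : ((monicOf fun i : Fin n => coordGerm (Sum.inl i : Fin n ⊕ Fin r)) *
      (monicOf fun i : Fin r => coordGerm (Sum.inr i : Fin n ⊕ Fin r))).map
        (germAlgebra (Fin n ⊕ Fin r)).subtype = F.map (Germ.coeRingHom (𝓝 0)) := by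
    simp only [F, Polynomial.map_mul, map_monicOf]
    rfl
  have h₂ : F.coeff j = fun p =>
      (monicPoly (fun i => p (Sum.inl i)) * monicPoly (fun i => p (Sum.inr i))).coeff j := by
    funext p
    have : F.map (Pi.evalRingHom _ p) =
        monicPoly (fun i => p (Sum.inl i)) * monicPoly (fun i => p (Sum.inr i)) := by
      simp only [F, Polynomial.map_mul, map_monicOf]
      rfl
    rw [← this, coeff_map]
    rfl
  rw [← h₂]
  have := congrArg (fun P => coeff P j) h₁
  simpa only [coeff_map] using this

theorem mulIdeal_eq_factorIdeal :
    mulIdeal n r = factorIdeal (isEmptyElim : Empty → germAlgebra (Fin n ⊕ Fin r))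
      (monicOf fun i : Fin n => coordGerm (Sum.inl i : Fin n ⊕ Fin r))
      (monicOf fun i : Fin r => coordGerm (Sum.inr i : Fin n ⊕ Fin r)) 0 0 := by
  rw [factorIdeal, Set.range_eq_empty, Ideal.span_empty, bot_sup_eq, lowerIdeal,
    natDegree_pow_mul_pow (monic_monicOf _) (monic_monicOf _), natDegree_monicOf,
    natDegree_monicOf]
  simp only [zero_add, one_mul, pow_one]
  set P := (monicOf fun i : Fin n => coordGerm (Sum.inl i : Fin n ⊕ Fin r)) *
    (monicOf fun i : Fin r => coordGerm (Sum.inr i : Fin n ⊕ Fin r)) with hP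
  have hPm : P.Monic := (monic_monicOf _).mul (monic_monicOf _)
  have hPd : P.natDegree = n + r := by
    rw [hP, (monic_monicOf _).natDegree_mul (monic_monicOf _), natDegree_monicOf,
      natDegree_monicOf]
  have hgerm : ∀ j : Fin (n + r), germOf (fun p => mulMap n r p j) (mulMap_analyticAt n r j) =
      (P - X ^ (n + r)).coeff j := fun j => by
    rw [coeff_sub, coeff_X_pow, if_neg j.2.ne, sub_zero]
    exact Subtype.ext (coe_coeff_monicOf_mul n r j).symm
  refine le_antisymm (Ideal.span_mono ?_) (Ideal.span_le.2 ?_)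
  · rintro _ ⟨j, rfl⟩
    exact ⟨j, (hgerm j).symm⟩
  · rintro _ ⟨j, rfl⟩
    rcases lt_trichotomy j (n + r) with hj | rfl | hj
    · exact Ideal.subset_span ⟨⟨j, hj⟩, hgerm ⟨j, hj⟩⟩
    · have := hPm.coeff_natDegree
      rw [hPd] at this
      rw [coeff_sub, this, coeff_X_pow, if_pos rfl, sub_self]
      exact Ideal.zero_mem _
    · rw [coeff_sub, coeff_X_pow, if_neg hj.ne', coeff_eq_zero_of_natDegree_lt (hPd ▸ hj), sub_self]
      exact Ideal.zero_mem _

end MulMap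

end ThomBoardman

theorem theorem1p2 (n r : ℕ) (hnr : r ≤ n) :
    ThomBoardman.IsTBSymbol (ThomBoardman.euclidTuple n r) (ThomBoardman.mulIdeal n r) := by
  have h := (ThomBoardman.isFactorSystem_coordGerm n r).isTBSymbol 0 0 rfl
  rwa [← ThomBoardman.mulIdeal_eq_factorIdeal, ThomBoardman.natDegree_monicOf,
    ThomBoardman.natDegree_monicOf] at h
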